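/- Let $\rho_0,\rho_1$ be density operators on a $D$-dimensional Hilbert space $\mathcal H$, let $0\le t\le 1$, and give $\rho_0,\rho_1$ the prior probabilities $1-t$ and $t$. For a measurement (POVM) $\{E_b\}$ with finitely many outcomes let $p_k(b)=\mathrm{tr}(\rho_kE_b)$, $p=(1-t)p_0+tp_1$ and $$J=H(p)-(1-t)H(p_0)-tH(p_1),\qquad H(q)=-\sum_b q(b)\ln q(b)\quad(0\ln 0=0),$$ and let the accessible information $I(\rho_0|\rho_1)$ be the supremum of $J$ over all such measurements (on the space on which the two states live). A purification of $\rho_k$ is a vector $\psi_k\in\mathcal H\otimes\mathbb C^d$ ($d$ finite) with $\mathrm{tr}_{\mathbb C^d}|\psi_k\rangle\langle\psi_k|=\rho_k$; the two members of a pair of purifications live in the same space. Let $F(\rho_0,\rho_1)=\mathrm{tr}\sqrt{\rho_1^{1/2}\rho_0\rho_1^{1/2}}$. For $0\le q\le 1$ put $n=\sqrt{1-4t(1-t)q}$ and $$\begin{aligned}B(t,q)=\frac1{2n}\Big\{&(1-t)\Big[(n+1-2tq)\ln\tfrac{1+n}{2(1-t)}+(n-1+2tq)\ln\tfrac{1-n}{2(1-t)}\Big]\\&+t\Big[(n+1-2(1-t)q)\ln\tfrac{1+n}{2t}+(n-1+2(1-t)q)\ln\tfrac{1-n}{2t}\Big]\Big\},\end{aligned}$$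 where a logarithmic term with coefficient $0$ counts as $0$, as does $B$ itself in the only case with $n=0$, namely $t=\frac12$, $q=1$. Then the supremum defining $I(\rho_0|\rho_1)$ is finite, and: 1. For every pair of purifications $\psi_0,\psi_1$ of $\rho_0,\rho_1$, $$I(\rho_0|\rho_1)\le I(|\psi_0\rangle\langle\psi_0|\,\big|\,|\psi_1\rangle\langle\psi_1|)=B\big(t,|\langle\psi_0|\psi_1\rangle|^2\big),$$ where the accessible information of the pure states is attained by some measurement. 2. Every pair of purifications satisfies $|\langle\psi_0|\psi_1\rangle|^2\le F(\rho_0,\rho_1)^2$, with equality for some pair, which can be chosen with $d=D$; and $q\mapsto B(t,q)$ is nonincreasing on $[0,1]$. 3. Consequently, with $P(t)=B\big(t,F(\rho_0,\rho_1)^2\big)$, $$I(\rho_0|\rho_1)\le P(t),$$ and $P(t)$ is the least value of $I(|\psi_0\rangle\langle\psi_0|\,\big|\,|\psi_1\rangle\langle\psi_1|)$ over all pairs of purifications of $\rho_0,\rho_1$; that is, it is the best upper bound of this kind. -/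

import Mathlib

open scoped MatrixOrder ComplexOrder

noncomputable section

/-- Density operators on a finite-dimensional Hilbert space with orthonormal basis
indexed by `ι`. -/
structure IsDensityOperator {ι : Type*} [Fintype ι] (ρ : Matrix ι ι ℂ) : Prop where
  posSemidef : ρ.PosSemidef
  trace_eq_one : ρ.trace = 1

/-- A measurement (POVM) with finitely many outcomes `b : Fin m`. -/
structure IsMeasurement {ι : Type*} [DecidableEq ι] {m : ℕ}
    (E : Fin m → Matrix ι ι ℂ) : Prop where
  posSemidef : ∀ b, (E b).PosSemidef
  sum_eq_one : ∑ b, E b = 1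

/-- The probability `tr (ρ E_b)` of the outcome `b` in the state `ρ`. -/
def outcomeProb {ι : Type*} [Fintype ι] {m : ℕ} (ρ : Matrix ι ι ℂ)
    (E : Fin m → Matrix ι ι ℂ) (b : Fin m) : ℝ :=
  (ρ * E b).trace.re

/-- Shannon information in nats, with the convention `0 ln 0 = 0`. -/
def shannonInfo {m : ℕ} (q : Fin m → ℝ) : ℝ :=
  -∑ b, q b * Real.log (q b)

/-- The average state `(1 - t) ρ₀ + t ρ₁`. -/
def averageState {ι : Type*} (t : ℝ) (ρ₀ ρ₁ : Matrix ι ι ℂ) : Matrix ι ι ℂ :=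
  ((1 - t : ℝ) : ℂ) • ρ₀ + (t : ℂ) • ρ₁

/-- Mutual information `J = H(p) - (1-t) H(p₀) - t H(p₁)` of the binary channel with signal
states `ρ₀`, `ρ₁` and prior probabilities `1 - t`, `t`, with respect to a measurement. -/
def mutualInfo {ι : Type*} [Fintype ι] {m : ℕ} (t : ℝ) (ρ₀ ρ₁ : Matrix ι ι ℂ)
    (E : Fin m → Matrix ι ι ℂ) : ℝ :=
  shannonInfo (outcomeProb (averageState t ρ₀ ρ₁) E)
    - (1 - t) * shannonInfo (outcomeProb ρ₀ E) - t * shannonInfo (outcomeProb ρ₁ E)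

/-- All values that the mutual information takes as the measurement varies. -/
def mutualInfoValues {ι : Type*} [Fintype ι] [DecidableEq ι] (t : ℝ)
    (ρ₀ ρ₁ : Matrix ι ι ℂ) : Set ℝ :=
  {x | ∃ (m : ℕ) (E : Fin m → Matrix ι ι ℂ), IsMeasurement E ∧ x = mutualInfo t ρ₀ ρ₁ E}

/-- Accessible information: the mutual information optimized over all measurements. -/
def accessibleInfo {ι : Type*} [Fintype ι] [DecidableEq ι] (t : ℝ)
    (ρ₀ ρ₁ : Matrix ι ι ℂ) : ℝ :=
  sSup (mutualInfoValues t ρ₀ ρ₁)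

/-- The operator `|ψ⟩⟨ψ|`. -/
def ketBra {ι : Type*} (ψ : EuclideanSpace ℂ ι) : Matrix ι ι ℂ :=
  fun i j => ψ i * star (ψ j)

/-- Partial trace over the second factor. -/
def partialTrace {ι κ : Type*} [Fintype κ] (M : Matrix (ι × κ) (ι × κ) ℂ) : Matrix ι ι ℂ :=
  fun i j => ∑ b, M (i, b) (j, b)

/-- `ψ`, a vector of the composite space, is a purification of `ρ`. It is a unit vector as
soon as `ρ` has trace one. -/
def IsPurification {ι κ : Type*} [Fintype κ] (ψ : EuclideanSpace ℂ (ι × κ))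
    (ρ : Matrix ι ι ℂ) : Prop :=
  partialTrace (ketBra ψ) = ρ

/-- The quantum fidelity `tr √(ρ₁^{1/2} ρ₀ ρ₁^{1/2})`. -/
def fidelity {ι : Type*} [Fintype ι] [DecidableEq ι] (ρ₀ ρ₁ : Matrix ι ι ℂ) : ℝ :=
  (CFC.sqrt (CFC.sqrt ρ₁ * ρ₀ * CFC.sqrt ρ₁)).trace.re

/-- The norm `n = √(1 - 4t(1-t)q)`. -/
def helstromNorm (t q : ℝ) : ℝ := Real.sqrt (1 - 4 * t * (1 - t) * q)

/-- The closed form, with `n = helstromNorm t q`, for two pure states of squared overlap `q`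
and priors `1 - t`, `t`. For `0 ≤ t ≤ 1`, `0 ≤ q ≤ 1`: a logarithm of `0` or of a quotient
by `0` occurs only with coefficient `0`; the norm `n` vanishes only when `t = 1/2` and `q = 1`,
and then the expression is `0`, which is its limit value. -/
def pureStateInfo (t q : ℝ) : ℝ :=
  let n := helstromNorm t q
  1 / (2 * n) *
    ((1 - t) * ((n + 1 - 2 * t * q) * Real.log ((1 + n) / (2 * (1 - t)))
        + (n - 1 + 2 * t * q) * Real.log ((1 - n) / (2 * (1 - t))))
      + t * ((n + 1 - 2 * (1 - t) * q) * Real.log ((1 + n) / (2 * t))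
        + (n - 1 + 2 * (1 - t) * q) * Real.log ((1 - n) / (2 * t))))

/-- The bound `P(t)`: the closed form at `q = F(ρ₀, ρ₁)²`. -/
def purificationBound {ι : Type*} [Fintype ι] [DecidableEq ι] (t : ℝ)
    (ρ₀ ρ₁ : Matrix ι ι ℂ) : ℝ :=
  pureStateInfo t (fidelity ρ₀ ρ₁ ^ 2)

/-- The values of the accessible information over all pairs of purifications of `ρ₀`, `ρ₁`,
with auxiliary systems of any finite dimension `k`. -/
def purificationInfoValues {ι : Type*} [Fintype ι] [DecidableEq ι] (t : ℝ)
    (ρ₀ ρ₁ : Matrix ι ι ℂ) : Set ℝ :=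
  {x | ∃ (k : ℕ) (ψ₀ ψ₁ : EuclideanSpace ℂ (ι × Fin k)),
    IsPurification ψ₀ ρ₀ ∧ IsPurification ψ₁ ρ₁ ∧
      x = accessibleInfo t (ketBra ψ₀) (ketBra ψ₁)}

end

/-!
Given a measurement outcome, the entropy of the signal is a convex increasing function of its
concurrence, by the monotonicity of `x / sinh x`. Jensen's inequality therefore bounds the mutual
information in terms of the Bhattacharyya overlap `∑ b, √(p₀ b * p₁ b)`, and for pure states
Cauchy–Schwarz bounds this overlap below by `|⟨ψ₀|ψ₁⟩|`. In an eigenbasis of the Helstrom operator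
`(1 - t) |ψ₀⟩⟨ψ₀| - t |ψ₁⟩⟨ψ₁|` all outcomes have the same concurrence, so both inequalities are
equalities.

For mixed states, discarding the auxiliary system of a purification only restricts the
measurements, so every pair of purifications gives an upper bound, and by Uhlmann's theorem their
largest overlap is the fidelity.
-/

section Entropy

/-- The entropy of a binary distribution `(r, 1 - r)` as a function of its concurrence
`s = 2 √(r (1 - r))`. -/
noncomputable def concurrenceEntropy (s : ℝ) : ℝ :=
  Real.binEntropy ((1 + √(1 - s ^ 2)) / 2)

theorem antitoneOn_div_sinh : AntitoneOn (fun x => x / Real.sinh x) (Set.Ioi 0) := by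
  have hconvex : ConvexOn ℝ (Set.Ici 0) Real.sinh := by
    refine MonotoneOn.convexOn_of_deriv (convex_Ici 0) Real.continuous_sinh.continuousOn
      Real.differentiable_sinh.differentiableOn ?_
    rw [Real.deriv_sinh, interior_Ici]
    exact Real.cosh_strictMonoOn.monotoneOn.mono Set.Ioi_subset_Ici_self
  intro x (hx : 0 < x) y (hy : 0 < y) hxy
  have hslope := hconvex.slope_mono Set.self_mem_Ici ⟨hx.le, hx.ne'⟩ ⟨hy.le, hy.ne'⟩ hxy
  simp only [slope_def_field, Real.sinh_zero, sub_zero] at hslope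
  simpa only [inv_div] using inv_anti₀ (div_pos (Real.sinh_pos_iff.2 hx) hx) hslope

theorem sqrt_one_sub_sq_mem_Ioo {s : ℝ} (hs : s ∈ Set.Ioo 0 1) :
    √(1 - s ^ 2) ∈ Set.Ioo 0 1 := by
  obtain ⟨hs₀, hs₁⟩ := hs
  refine ⟨Real.sqrt_pos.2 (by nlinarith), ?_⟩
  rw [Real.sqrt_lt' one_pos]
  nlinarith

theorem hasDerivAt_concurrenceEntropy {s : ℝ} (hs : s ∈ Set.Ioo 0 1) :
    HasDerivAt concurrenceEntropy
      (Real.artanh √(1 - s ^ 2) / Real.sinh (Real.artanh √(1 - s ^ 2))) s := by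
  have hpos : 0 < 1 - s ^ 2 := by nlinarith [hs.1, hs.2]
  obtain ⟨hu₀, hu₁⟩ := sqrt_one_sub_sq_mem_Ioo hs
  have hinner : HasDerivAt (fun s : ℝ => (1 + √(1 - s ^ 2)) / 2)
      (-(2 * s) / (2 * √(1 - s ^ 2)) / 2) s := by
    have hsq : HasDerivAt (fun s : ℝ => 1 - s ^ 2) (-(2 * s)) s := by
      simpa using (hasDerivAt_pow 2 s).const_sub 1
    exact ((hsq.sqrt hpos.ne').const_add 1).div_const 2
  have houter := Real.hasDerivAt_binEntropy (p := (1 + √(1 - s ^ 2)) / 2)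
    (by positivity) (by linarith)
  refine (houter.comp s hinner).congr_deriv ?_
  rw [Real.sinh_artanh ⟨by linarith, hu₁⟩, Real.artanh_eq_half_log ⟨by linarith, hu₁.le⟩,
    Real.sq_sqrt hpos.le, sub_sub_cancel, Real.sqrt_sq hs.1.le]
  set u := √(1 - s ^ 2)
  have hcompl : 1 - (1 + u) / 2 = (1 - u) / 2 := by ring
  rw [hcompl, Real.log_div (by linarith) (by linarith), Real.log_div (by linarith) two_ne_zero,
    Real.log_div (by linarith) (by linarith)]
  field_simp
  ring

theorem convexOn_concurrenceEntropy : ConvexOn ℝ (Set.Icc 0 1) concurrenceEntropy := by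
  have hcont : Continuous concurrenceEntropy := by
    unfold concurrenceEntropy
    fun_prop
  refine MonotoneOn.convexOn_of_deriv (convex_Icc 0 1) hcont.continuousOn ?_ ?_
  · rw [interior_Icc]
    exact fun s hs => (hasDerivAt_concurrenceEntropy hs).differentiableAt.differentiableWithinAt
  · rw [interior_Icc]
    intro s hs r hr hsr
    rw [(hasDerivAt_concurrenceEntropy hs).deriv, (hasDerivAt_concurrenceEntropy hr).deriv]
    have hu := sqrt_one_sub_sq_mem_Ioo hs
    have hv := sqrt_one_sub_sq_mem_Ioo hr
    refine antitoneOn_div_sinh (Real.artanh_pos hv) (Real.artanh_pos hu)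
      (Real.artanh_le_artanh (by linarith [hv.1]) hu.2 (Real.sqrt_le_sqrt ?_))
    nlinarith [hs.1]

theorem monotoneOn_concurrenceEntropy : MonotoneOn concurrenceEntropy (Set.Ici 0) := by
  intro s (hs : 0 ≤ s) r _ hsr
  have hle : √(1 - r ^ 2) ≤ √(1 - s ^ 2) := Real.sqrt_le_sqrt (by nlinarith)
  have hmem : ∀ x : ℝ, (1 + √(1 - x ^ 2)) / 2 ∈ Set.Icc (2⁻¹ : ℝ) 1 := fun x =>
    ⟨by linarith [Real.sqrt_nonneg (1 - x ^ 2)],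
      by linarith [Real.sqrt_le_one.2 (sub_le_self 1 (sq_nonneg x))]⟩
  exact Real.binEntropy_strictAntiOn.antitoneOn (hmem r) (hmem s) (by linarith)

theorem concurrenceEntropy_two_mul_sqrt {r : ℝ} (hr₀ : 0 ≤ r) (hr₁ : r ≤ 1) :
    concurrenceEntropy (2 * √(r * (1 - r))) = Real.binEntropy r := by
  have hsq : 1 - (2 * √(r * (1 - r))) ^ 2 = (2 * r - 1) ^ 2 := by
    rw [mul_pow, Real.sq_sqrt (mul_nonneg hr₀ (sub_nonneg.2 hr₁))]
    ring
  rw [concurrenceEntropy, hsq, Real.sqrt_sq_eq_abs]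
  rcases abs_choice (2 * r - 1) with h | h <;> rw [h]
  · ring_nf
  · rw [← Real.binEntropy_one_sub]
    ring_nf

/-- The contribution of one measurement outcome to the conditional entropy of a binary signal
given the outcome, where `x` and `y` are the joint probabilities of the outcome with the two
signals. -/
noncomputable def pairEntropy (x y : ℝ) : ℝ :=
  x.negMulLog + y.negMulLog - (x + y).negMulLog

theorem pairEntropy_mul_one_sub_mul (p r : ℝ) :
    pairEntropy (p * r) (p * (1 - r)) = p * Real.binEntropy r := by
  rw [pairEntropy, ← mul_add, add_sub_cancel, mul_one, Real.negMulLog_mul, Real.negMulLog_mul,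
    Real.binEntropy_eq_negMulLog_add_negMulLog_one_sub]
  ring

theorem pairEntropy_eq_mul_concurrenceEntropy {x y s : ℝ} (hx : 0 ≤ x) (hy : 0 ≤ y)
    (hs : 2 * √(x * y) = (x + y) * s) :
    pairEntropy x y = (x + y) * concurrenceEntropy s := by
  rcases (add_nonneg hx hy).eq_or_lt' with hp | hp
  · obtain ⟨rfl, rfl⟩ := (add_eq_zero_iff_of_nonneg hx hy).1 hp
    simp [pairEntropy]
  obtain ⟨r, hr₀, hr₁, hxr, hyr⟩ :
      ∃ r, 0 ≤ r ∧ r ≤ 1 ∧ x = (x + y) * r ∧ y = (x + y) * (1 - r) :=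
    ⟨x / (x + y), div_nonneg hx hp.le, (div_le_one hp).2 (le_add_of_nonneg_right hy),
      by field_simp, by field_simp; ring⟩
  generalize x + y = p at hp hxr hyr hs ⊢
  subst hxr hyr
  rw [pairEntropy_mul_one_sub_mul, ← concurrenceEntropy_two_mul_sqrt hr₀ hr₁]
  congr 2
  refine mul_left_cancel₀ hp.ne' (Eq.trans ?_ hs)
  rw [mul_mul_mul_comm, Real.sqrt_mul (mul_self_nonneg p), Real.sqrt_mul_self hp.le]
  ring

theorem concurrenceEntropy_sum_le_sum_pairEntropy {β : Type*} [Fintype β] {x y : β → ℝ}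
    (hx : ∀ b, 0 ≤ x b) (hy : ∀ b, 0 ≤ y b) (hsum : ∑ b, (x b + y b) = 1) :
    concurrenceEntropy (2 * ∑ b, √(x b * y b)) ≤ ∑ b, pairEntropy (x b) (y b) := by
  have hconc : ∀ b, ∃ s ∈ Set.Icc (0 : ℝ) 1, 2 * √(x b * y b) = (x b + y b) * s := by
    intro b
    have hp := add_nonneg (hx b) (hy b)
    have hle : 2 * √(x b * y b) ≤ x b + y b := by
      nlinarith [sq_nonneg (√(x b) - √(y b)), Real.sq_sqrt (hx b), Real.sq_sqrt (hy b),
        Real.sqrt_mul (hx b) (y b)]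
    refine ⟨2 * √(x b * y b) / (x b + y b), ⟨by positivity, div_le_one_of_le₀ hle hp⟩, ?_⟩
    exact (mul_div_cancel_of_imp' fun h => le_antisymm (h ▸ hle) (by positivity)).symm
  choose s hs hconc using hconc
  calc concurrenceEntropy (2 * ∑ b, √(x b * y b))
      = concurrenceEntropy (∑ b, (x b + y b) • s b) := by
        simp only [Finset.mul_sum, hconc, smul_eq_mul]
    _ ≤ ∑ b, (x b + y b) • concurrenceEntropy (s b) :=
        convexOn_concurrenceEntropy.map_sum_le (fun b _ => add_nonneg (hx b) (hy b)) hsum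
          fun b _ => hs b
    _ = ∑ b, pairEntropy (x b) (y b) :=
        Finset.sum_congr rfl fun b _ =>
          (pairEntropy_eq_mul_concurrenceEntropy (hx b) (hy b) (hconc b)).symm

theorem mul_log_div {a x y : ℝ} (hx : x = 0 → a = 0) (hy : y = 0 → a = 0) :
    a * Real.log (x / y) = a * Real.log x - a * Real.log y := by
  rcases eq_or_ne a 0 with rfl | ha
  · simp
  · rw [Real.log_div (mt hx ha) (mt hy ha), mul_sub]

theorem helstromNorm_sq {t q : ℝ} (ht₀ : 0 ≤ t) (ht₁ : t ≤ 1) (hq₁ : q ≤ 1) :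
    helstromNorm t q ^ 2 = 1 - 4 * t * (1 - t) * q :=
  Real.sq_sqrt (by nlinarith [sq_nonneg (1 - 2 * t), mul_nonneg ht₀ (sub_nonneg.2 ht₁)])

theorem concurrenceEntropy_eq_binEntropy_helstromNorm {t q : ℝ} (h : 0 ≤ t * (1 - t) * q) :
    concurrenceEntropy (2 * √(t * (1 - t) * q)) = Real.binEntropy ((1 + helstromNorm t q) / 2) := by
  rw [concurrenceEntropy, mul_pow, Real.sq_sqrt h, helstromNorm]
  ring_nf

theorem pureStateInfo_eq {t q : ℝ} (ht₀ : 0 ≤ t) (ht₁ : t ≤ 1) (hq₀ : 0 ≤ q) (hq₁ : q ≤ 1) :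
    pureStateInfo t q = Real.binEntropy t - concurrenceEntropy (2 * √(t * (1 - t) * q)) := by
  have hw : 0 ≤ t * (1 - t) * q := mul_nonneg (mul_nonneg ht₀ (sub_nonneg.2 ht₁)) hq₀
  have hn₀ : 0 ≤ helstromNorm t q := Real.sqrt_nonneg _
  have hn := helstromNorm_sq ht₀ ht₁ hq₁
  rw [concurrenceEntropy_eq_binEntropy_helstromNorm hw, pureStateInfo]
  set n := helstromNorm t q
  rcases hn₀.eq_or_lt' with hn_zero | hn_pos
  · have ht : t = 2⁻¹ := by nlinarith [sq_nonneg (1 - 2 * t), mul_nonneg ht₀ (sub_nonneg.2 ht₁)]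
    norm_num [hn_zero, ht]
  have hne : (1 + n) / 2 ≠ 0 := by positivity
  have hzero : (1 - n) / 2 = 0 → t * (1 - t) * q = 0 := fun h => by
    nlinarith [sub_eq_zero.1 ((div_eq_zero_iff.1 h).resolve_right two_ne_zero)]
  have hlog₀ := mul_log_div (a := (1 - t) * (n + 1 - 2 * t * q)) (x := (1 + n) / 2) (y := 1 - t)
    (fun h => absurd h hne) fun h => by simp [h]
  have hlog₀' := mul_log_div (a := (1 - t) * (n - 1 + 2 * t * q)) (x := (1 - n) / 2) (y := 1 - t)
    (fun h => by linear_combination 2 * hzero h - 2 * (1 - t) * h) fun h => by simp [h]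
  have hlog₁ := mul_log_div (a := t * (n + 1 - 2 * (1 - t) * q)) (x := (1 + n) / 2) (y := t)
    (fun h => absurd h hne) fun h => by simp [h]
  have hlog₁' := mul_log_div (a := t * (n - 1 + 2 * (1 - t) * q)) (x := (1 - n) / 2) (y := t)
    (fun h => by linear_combination 2 * hzero h - 2 * t * h) fun h => by simp [h]
  have hcompl : 1 - (1 + n) / 2 = (1 - n) / 2 := by ring
  simp only [Real.binEntropy_eq_negMulLog_add_negMulLog_one_sub, Real.negMulLog, hcompl]
  rw [one_div, inv_mul_eq_iff_eq_mul₀ (by positivity)]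
  simp only [← div_div]
  linear_combination hlog₀ + hlog₀' + hlog₁ + hlog₁'
    - hn * (Real.log ((1 + n) / 2) - Real.log ((1 - n) / 2))

theorem antitoneOn_pureStateInfo {t : ℝ} (ht₀ : 0 ≤ t) (ht₁ : t ≤ 1) :
    AntitoneOn (fun q => pureStateInfo t q) (Set.Icc 0 1) := by
  intro q hq r hr hqr
  simp only [pureStateInfo_eq ht₀ ht₁ hq.1 hq.2, pureStateInfo_eq ht₀ ht₁ hr.1 hr.2]
  have hw : 0 ≤ t * (1 - t) := mul_nonneg ht₀ (sub_nonneg.2 ht₁)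
  refine sub_le_sub_left (monotoneOn_concurrenceEntropy ?_ ?_ ?_) _
  · exact Set.mem_Ici.2 (by positivity)
  · exact Set.mem_Ici.2 (by positivity)
  · gcongr 2 * √?_
    exact mul_le_mul_of_nonneg_left hqr hw

end Entropy

section MutualInfo

variable {ι : Type*} [Fintype ι] {m : ℕ}

theorem outcomeProb_averageState (t : ℝ) (ρ₀ ρ₁ : Matrix ι ι ℂ) (E : Fin m → Matrix ι ι ℂ) :
    outcomeProb (averageState t ρ₀ ρ₁) E =
      fun b => (1 - t) * outcomeProb ρ₀ E b + t * outcomeProb ρ₁ E b := by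
  funext b
  simp only [outcomeProb, averageState, add_mul, Matrix.smul_mul, Matrix.trace_add,
    Matrix.trace_smul, smul_eq_mul, Complex.add_re, Complex.re_ofReal_mul]

theorem mutualInfo_eq {t : ℝ} {ρ₀ ρ₁ : Matrix ι ι ℂ} {E : Fin m → Matrix ι ι ℂ}
    (h₀ : ∑ b, outcomeProb ρ₀ E b = 1) (h₁ : ∑ b, outcomeProb ρ₁ E b = 1) :
    mutualInfo t ρ₀ ρ₁ E = Real.binEntropy t
      - ∑ b, pairEntropy ((1 - t) * outcomeProb ρ₀ E b) (t * outcomeProb ρ₁ E b) := by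
  simp only [mutualInfo, outcomeProb_averageState, shannonInfo, pairEntropy, Real.negMulLog_mul,
    Finset.sum_sub_distrib, Finset.sum_add_distrib, ← Finset.sum_mul, ← Finset.mul_sum, h₀, h₁,
    Real.binEntropy_eq_negMulLog_add_negMulLog_one_sub]
  simp only [Real.negMulLog, neg_mul, Finset.sum_neg_distrib]
  ring

theorem outcomeProb_nonneg {ρ : Matrix ι ι ℂ} {E : Fin m → Matrix ι ι ℂ} (hρ : ρ.PosSemidef)
    {b : Fin m} (hE : (E b).PosSemidef) : 0 ≤ outcomeProb ρ E b := by
  classical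
  obtain ⟨B, hB⟩ := CStarAlgebra.nonneg_iff_eq_star_mul_self.1 hE.nonneg
  have htrace := (hρ.mul_mul_conjTranspose_same B).trace_nonneg
  rw [Matrix.trace_mul_comm, ← Matrix.mul_assoc, Matrix.trace_mul_comm,
    ← Matrix.star_eq_conjTranspose, ← hB] at htrace
  exact (Complex.le_def.1 htrace).1

variable [DecidableEq ι]

theorem IsMeasurement.sum_outcomeProb {E : Fin m → Matrix ι ι ℂ} (hE : IsMeasurement E)
    (ρ : Matrix ι ι ℂ) : ∑ b, outcomeProb ρ E b = ρ.trace.re := by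
  simp only [outcomeProb, ← Complex.re_sum, ← Matrix.trace_sum, ← Matrix.mul_sum, hE.sum_eq_one,
    mul_one]

theorem IsMeasurement.mutualInfo_le {E : Fin m → Matrix ι ι ℂ} (hE : IsMeasurement E)
    {ρ₀ ρ₁ : Matrix ι ι ℂ} (h₀ : IsDensityOperator ρ₀) (h₁ : IsDensityOperator ρ₁)
    {t : ℝ} (ht₀ : 0 ≤ t) (ht₁ : t ≤ 1) :
    mutualInfo t ρ₀ ρ₁ E ≤ Real.binEntropy t - concurrenceEntropy
      (2 * √(t * (1 - t)) * ∑ b, √(outcomeProb ρ₀ E b * outcomeProb ρ₁ E b)) := by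
  have hsum₀ : ∑ b, outcomeProb ρ₀ E b = 1 := by simp [hE.sum_outcomeProb, h₀.trace_eq_one]
  have hsum₁ : ∑ b, outcomeProb ρ₁ E b = 1 := by simp [hE.sum_outcomeProb, h₁.trace_eq_one]
  have hx : ∀ b, 0 ≤ (1 - t) * outcomeProb ρ₀ E b := fun b =>
    mul_nonneg (sub_nonneg.2 ht₁) (outcomeProb_nonneg h₀.posSemidef (hE.posSemidef b))
  have hy : ∀ b, 0 ≤ t * outcomeProb ρ₁ E b := fun b =>
    mul_nonneg ht₀ (outcomeProb_nonneg h₁.posSemidef (hE.posSemidef b))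
  have hJensen := concurrenceEntropy_sum_le_sum_pairEntropy hx hy (by
    simp only [Finset.sum_add_distrib, ← Finset.mul_sum, hsum₀, hsum₁]
    ring)
  have hsqrt : ∀ b, √((1 - t) * outcomeProb ρ₀ E b * (t * outcomeProb ρ₁ E b))
      = √(t * (1 - t)) * √(outcomeProb ρ₀ E b * outcomeProb ρ₁ E b) := fun b => by
    rw [← Real.sqrt_mul (mul_nonneg ht₀ (sub_nonneg.2 ht₁))]
    ring_nf
  rw [mutualInfo_eq hsum₀ hsum₁]
  simp only [hsqrt, ← Finset.mul_sum] at hJensen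
  rw [← mul_assoc] at hJensen
  exact sub_le_sub_left hJensen _

theorem mutualInfoValues_nonempty (t : ℝ) (ρ₀ ρ₁ : Matrix ι ι ℂ) :
    (mutualInfoValues t ρ₀ ρ₁).Nonempty :=
  ⟨_, 1, fun _ => 1, ⟨fun _ => Matrix.PosSemidef.one, by simp⟩, rfl⟩

end MutualInfo

section PureStates

variable {ι : Type*} [Fintype ι] {m : ℕ}

theorem ketBra_eq_vecMulVec {ι : Type*} (ψ : EuclideanSpace ℂ ι) :
    ketBra ψ = Matrix.vecMulVec ψ (star ⇑ψ) := rfl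

theorem trace_ketBra (ψ : EuclideanSpace ℂ ι) : (ketBra ψ).trace = ‖ψ‖ ^ 2 := by
  rw [← Complex.coe_algebraMap, ← inner_self_eq_norm_sq_to_K]
  rfl

theorem isDensityOperator_ketBra {ψ : EuclideanSpace ℂ ι} (h : ‖ψ‖ = 1) :
    IsDensityOperator (ketBra ψ) :=
  ⟨Matrix.posSemidef_vecMulVec_self_star _, by simp [trace_ketBra, h]⟩

theorem toEuclideanLin_ketBra [DecidableEq ι] (ψ : EuclideanSpace ℂ ι) :
    (ketBra ψ).toEuclideanLin = (InnerProductSpace.rankOne ℂ ψ ψ).toLinearMap := by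
  rw [← LinearEquiv.eq_symm_apply, InnerProductSpace.symm_toEuclideanLin_rankOne]
  rfl

theorem trace_ketBra_mul [DecidableEq ι] (ψ : EuclideanSpace ℂ ι) (E : Matrix ι ι ℂ) :
    (ketBra ψ * E).trace = inner ℂ ψ (E.toEuclideanLin ψ) := by
  rw [Matrix.trace_mul_comm, ketBra_eq_vecMulVec, Matrix.mul_vecMulVec, Matrix.trace_vecMulVec]
  rfl

theorem outcomeProb_ketBra_ketBra (ψ : EuclideanSpace ℂ ι) (e : Fin m → EuclideanSpace ℂ ι)
    (b : Fin m) : outcomeProb (ketBra ψ) (fun b => ketBra (e b)) b = ‖inner ℂ ψ (e b)‖ ^ 2 := by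
  classical
  rw [outcomeProb, trace_ketBra_mul, toEuclideanLin_ketBra, ContinuousLinearMap.coe_coe,
    InnerProductSpace.rankOne_apply, inner_smul_right]
  exact (inner_mul_symm_re_eq_norm (𝕜 := ℂ) _ _).trans (by rw [norm_mul, norm_inner_symm, sq])

theorem norm_inner_sq_mem_Icc {E : Type*} [NormedAddCommGroup E] [InnerProductSpace ℂ E] {ψ φ : E}
    (hψ : ‖ψ‖ = 1) (hφ : ‖φ‖ = 1) : ‖inner ℂ ψ φ‖ ^ 2 ∈ Set.Icc (0 : ℝ) 1 :=
  ⟨by positivity, pow_le_one₀ (norm_nonneg _) (by simpa [hψ, hφ] using norm_inner_le_norm ψ φ)⟩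

theorem inner_mul_inner_eq_of_sub_eq_smul {𝕜 V : Type*} [RCLike 𝕜] [NormedAddCommGroup V]
    [InnerProductSpace 𝕜 V] {u v e : V} {a b l : ℝ}
    (h : (a * inner 𝕜 u e : 𝕜) • u - (b * inner 𝕜 v e : 𝕜) • v = (l : 𝕜) • e) :
    inner 𝕜 u e * inner 𝕜 e v * (a * ‖u‖ ^ 2 + b * ‖v‖ ^ 2 : ℝ)
      = inner 𝕜 u v * (a * ‖inner 𝕜 u e‖ ^ 2 + b * ‖inner 𝕜 v e‖ ^ 2 : ℝ) := by
  -- Eliminate `l` between the pairings of the eigenvalue equation with `u` and `v`.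
  have hu := congrArg (inner 𝕜 u) h
  have hv := congrArg (inner 𝕜 · v) h
  simp only [inner_sub_right, inner_sub_left, inner_smul_right, inner_smul_left, map_mul,
    RCLike.conj_ofReal, inner_conj_symm, inner_self_eq_norm_sq_to_K] at hu hv
  have hue : inner 𝕜 u e * inner 𝕜 e u = (‖inner 𝕜 u e‖ : 𝕜) ^ 2 := by
    rw [← inner_conj_symm e u, RCLike.mul_conj]
  have hve : inner 𝕜 v e * inner 𝕜 e v = (‖inner 𝕜 v e‖ : 𝕜) ^ 2 := by
    rw [← inner_conj_symm e v, RCLike.mul_conj]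
  push_cast
  rw [← hue, ← hve]
  linear_combination inner 𝕜 e v * hu - inner 𝕜 u e * hv

theorem exists_orthonormalBasis_helstrom (t : ℝ) (ψ₀ ψ₁ : EuclideanSpace ℂ ι) :
    ∃ (m : ℕ) (e : OrthonormalBasis (Fin m) ℂ (EuclideanSpace ℂ ι)) (l : Fin m → ℝ), ∀ b,
      ((1 - t : ℝ) * inner ℂ ψ₀ (e b) : ℂ) • ψ₀ - (t * inner ℂ ψ₁ (e b) : ℂ) • ψ₁
        = (l b : ℂ) • e b := by
  classical
  have hsymm : (((1 - t : ℝ) : ℂ) • ketBra ψ₀ - (t : ℂ) • ketBra ψ₁).toEuclideanLin.IsSymmetric :=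
    Matrix.isSymmetric_toEuclideanLin_iff.2 <|
      ((Matrix.posSemidef_vecMulVec_self_star _).isHermitian.smul (Complex.conj_ofReal _)).sub
        ((Matrix.posSemidef_vecMulVec_self_star _).isHermitian.smul (Complex.conj_ofReal _))
  refine ⟨_, hsymm.eigenvectorBasis finrank_euclideanSpace,
    hsymm.eigenvalues finrank_euclideanSpace, fun b => ?_⟩
  refine Eq.trans ?_ (hsymm.apply_eigenvectorBasis finrank_euclideanSpace b)
  simp only [map_sub, map_smul, LinearMap.sub_apply, LinearMap.smul_apply, toEuclideanLin_ketBra,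
    ContinuousLinearMap.coe_coe, InnerProductSpace.rankOne_apply, smul_smul]

variable [DecidableEq ι]

theorem inner_toEuclideanLin_conjTranspose_mul_self {𝕜 κ : Type*} [RCLike 𝕜] [Fintype κ]
    (A : Matrix κ ι 𝕜) (x y : EuclideanSpace 𝕜 ι) :
    inner 𝕜 x ((A.conjTranspose * A).toEuclideanLin y)
      = inner 𝕜 (A.toEuclideanLin x) (A.toEuclideanLin y) := by
  classical
  rw [Matrix.toLpLin_mul_same, Matrix.toEuclideanLin_conjTranspose_eq_adjoint,
    LinearMap.comp_apply, LinearMap.adjoint_inner_right]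

theorem norm_inner_toEuclideanLin_le {E : Matrix ι ι ℂ} (hE : E.PosSemidef)
    (ψ φ : EuclideanSpace ℂ ι) :
    ‖inner ℂ ψ (E.toEuclideanLin φ)‖
      ≤ √((ketBra ψ * E).trace.re * (ketBra φ * E).trace.re) := by
  obtain ⟨B, rfl⟩ := CStarAlgebra.nonneg_iff_eq_star_mul_self.1 hE.nonneg
  have hre : ∀ x : EuclideanSpace ℂ ι, (inner ℂ x x).re = ‖x‖ ^ 2 := inner_self_eq_norm_sq (𝕜 := ℂ)
  simp only [trace_ketBra_mul, Matrix.star_eq_conjTranspose,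
    inner_toEuclideanLin_conjTranspose_mul_self, hre, ← mul_pow]
  rw [Real.sqrt_sq (by positivity)]
  exact norm_inner_le_norm _ _

theorem IsMeasurement.norm_inner_le_sum_sqrt {E : Fin m → Matrix ι ι ℂ} (hE : IsMeasurement E)
    (ψ φ : EuclideanSpace ℂ ι) :
    ‖inner ℂ ψ φ‖ ≤ ∑ b, √(outcomeProb (ketBra ψ) E b * outcomeProb (ketBra φ) E b) :=
  calc ‖inner ℂ ψ φ‖ = ‖∑ b, inner ℂ ψ ((E b).toEuclideanLin φ)‖ := by
        rw [← inner_sum, ← LinearMap.sum_apply, ← map_sum, hE.sum_eq_one, Matrix.toLpLin_one,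
          LinearMap.id_apply]
    _ ≤ ∑ b, ‖inner ℂ ψ ((E b).toEuclideanLin φ)‖ := norm_sum_le _ _
    _ ≤ _ := Finset.sum_le_sum fun b _ => norm_inner_toEuclideanLin_le (hE.posSemidef b) ψ φ

theorem IsMeasurement.mutualInfo_ketBra_le {E : Fin m → Matrix ι ι ℂ} (hE : IsMeasurement E)
    {ψ₀ ψ₁ : EuclideanSpace ℂ ι} (h₀ : ‖ψ₀‖ = 1) (h₁ : ‖ψ₁‖ = 1)
    {t : ℝ} (ht₀ : 0 ≤ t) (ht₁ : t ≤ 1) :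
    mutualInfo t (ketBra ψ₀) (ketBra ψ₁) E ≤ pureStateInfo t (‖inner ℂ ψ₀ ψ₁‖ ^ 2) := by
  have hq := norm_inner_sq_mem_Icc h₀ h₁
  rw [pureStateInfo_eq ht₀ ht₁ hq.1 hq.2, Real.sqrt_mul (mul_nonneg ht₀ (sub_nonneg.2 ht₁)),
    Real.sqrt_sq (norm_nonneg _), ← mul_assoc]
  refine (hE.mutualInfo_le (isDensityOperator_ketBra h₀)
    (isDensityOperator_ketBra h₁) ht₀ ht₁).trans (sub_le_sub_left ?_ _)
  refine monotoneOn_concurrenceEntropy (Set.mem_Ici.2 (by positivity))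
    (Set.mem_Ici.2 (by positivity)) ?_
  gcongr
  exact hE.norm_inner_le_sum_sqrt ψ₀ ψ₁

theorem IsMeasurement.of_orthonormalBasis (e : OrthonormalBasis (Fin m) ℂ (EuclideanSpace ℂ ι)) :
    IsMeasurement fun b => ketBra (e b) := by
  refine ⟨fun b => Matrix.posSemidef_vecMulVec_self_star _, Matrix.toEuclideanLin.injective ?_⟩
  simp only [map_sum, toEuclideanLin_ketBra, Matrix.toLpLin_one]
  rw [← ContinuousLinearMap.toLinearMap_sum, e.sum_rankOne_eq_id]
  rfl

theorem exists_isMeasurement_mutualInfo_ketBra_eq {ψ₀ ψ₁ : EuclideanSpace ℂ ι}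
    (h₀ : ‖ψ₀‖ = 1) (h₁ : ‖ψ₁‖ = 1) {t : ℝ} (ht₀ : 0 ≤ t) (ht₁ : t ≤ 1) :
    ∃ (m : ℕ) (E : Fin m → Matrix ι ι ℂ), IsMeasurement E ∧
      mutualInfo t (ketBra ψ₀) (ketBra ψ₁) E = pureStateInfo t (‖inner ℂ ψ₀ ψ₁‖ ^ 2) := by
  obtain ⟨m, e, l, hel⟩ := exists_orthonormalBasis_helstrom t ψ₀ ψ₁
  have hE := IsMeasurement.of_orthonormalBasis e
  have hsum : ∀ ψ : EuclideanSpace ℂ ι, ‖ψ‖ = 1 →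
      ∑ b, outcomeProb (ketBra ψ) (fun b => ketBra (e b)) b = 1 := fun ψ hψ => by
    simp [hE.sum_outcomeProb, (isDensityOperator_ketBra hψ).trace_eq_one]
  have := sub_nonneg.2 ht₁
  have hq := norm_inner_sq_mem_Icc h₀ h₁
  refine ⟨m, _, hE, ?_⟩
  rw [mutualInfo_eq (hsum ψ₀ h₀) (hsum ψ₁ h₁), pureStateInfo_eq ht₀ ht₁ hq.1 hq.2]
  congr 1
  have hpair : ∀ b, pairEntropy ((1 - t) * ‖inner ℂ ψ₀ (e b)‖ ^ 2) (t * ‖inner ℂ ψ₁ (e b)‖ ^ 2)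
      = ((1 - t) * ‖inner ℂ ψ₀ (e b)‖ ^ 2 + t * ‖inner ℂ ψ₁ (e b)‖ ^ 2)
        * concurrenceEntropy (2 * √(t * (1 - t) * ‖inner ℂ ψ₀ ψ₁‖ ^ 2)) := by
    intro b
    refine pairEntropy_eq_mul_concurrenceEntropy (by positivity) (by positivity) ?_
    have hkey := congrArg norm (inner_mul_inner_eq_of_sub_eq_smul (a := 1 - t) (l := l b) (hel b))
    simp only [norm_mul, h₀, h₁, norm_inner_symm (e b), one_pow, mul_one, sub_add_cancel,
      RCLike.norm_ofReal, abs_one] at hkey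
    rw [abs_of_nonneg (by positivity)] at hkey
    have hsq : (1 - t) * ‖inner ℂ ψ₀ (e b)‖ ^ 2 * (t * ‖inner ℂ ψ₁ (e b)‖ ^ 2)
        = ((1 - t) * ‖inner ℂ ψ₀ (e b)‖ ^ 2 + t * ‖inner ℂ ψ₁ (e b)‖ ^ 2) ^ 2
          * (t * (1 - t) * ‖inner ℂ ψ₀ ψ₁‖ ^ 2) := by
      rw [mul_mul_mul_comm, mul_comm (1 - t), ← mul_pow, hkey]
      ring
    rw [hsq, Real.sqrt_mul (sq_nonneg _), Real.sqrt_sq (by positivity)]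
    ring
  simp only [outcomeProb_ketBra_ketBra] at hsum ⊢
  simp only [hpair, ← Finset.sum_mul, Finset.sum_add_distrib, ← Finset.mul_sum, hsum _ h₀,
    hsum _ h₁]
  ring

theorem isGreatest_mutualInfoValues_ketBra {ψ₀ ψ₁ : EuclideanSpace ℂ ι}
    (h₀ : ‖ψ₀‖ = 1) (h₁ : ‖ψ₁‖ = 1) {t : ℝ} (ht₀ : 0 ≤ t) (ht₁ : t ≤ 1) :
    IsGreatest (mutualInfoValues t (ketBra ψ₀) (ketBra ψ₁))
      (pureStateInfo t (‖inner ℂ ψ₀ ψ₁‖ ^ 2)) := by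
  obtain ⟨m, E, hE, heq⟩ := exists_isMeasurement_mutualInfo_ketBra_eq h₀ h₁ ht₀ ht₁
  refine ⟨⟨m, E, hE, heq.symm⟩, ?_⟩
  rintro x ⟨m, E, hE, rfl⟩
  exact hE.mutualInfo_ketBra_le h₀ h₁ ht₀ ht₁

theorem accessibleInfo_ketBra {ψ₀ ψ₁ : EuclideanSpace ℂ ι} (h₀ : ‖ψ₀‖ = 1) (h₁ : ‖ψ₁‖ = 1)
    {t : ℝ} (ht₀ : 0 ≤ t) (ht₁ : t ≤ 1) :
    accessibleInfo t (ketBra ψ₀) (ketBra ψ₁) = pureStateInfo t (‖inner ℂ ψ₀ ψ₁‖ ^ 2) :=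
  (isGreatest_mutualInfoValues_ketBra h₀ h₁ ht₀ ht₁).csSup_eq

end PureStates

section PolarDecomposition

open scoped Matrix

variable {𝕜 : Type*} [RCLike 𝕜]

theorem exists_linearIsometry_range_apply_eq {E F G : Type*} [AddCommGroup E] [Module 𝕜 E]
    [NormedAddCommGroup F] [NormedSpace 𝕜 F] [NormedAddCommGroup G] [NormedSpace 𝕜 G]
    {f : E →ₗ[𝕜] F} {g : E →ₗ[𝕜] G} (h : ∀ x, ‖f x‖ = ‖g x‖) :
    ∃ L : LinearMap.range g →ₗᵢ[𝕜] F, ∀ x, L ⟨g x, LinearMap.mem_range_self g x⟩ = f x := by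
  have hker : LinearMap.ker g ≤ LinearMap.ker f := fun x hx => by
    rw [LinearMap.mem_ker, ← norm_eq_zero, h, LinearMap.mem_ker.1 hx, norm_zero]
  have hL : ∀ x, ((LinearMap.ker g).liftQ f hker ∘ₗ g.quotKerEquivRange.symm.toLinearMap)
      ⟨g x, LinearMap.mem_range_self g x⟩ = f x := fun x =>
    congrArg _ (g.quotKerEquivRange_symm_apply_image x (LinearMap.mem_range_self g x))
  refine ⟨⟨_, ?_⟩, hL⟩
  rintro ⟨-, x, rfl⟩
  exact (congrArg norm (hL x)).trans (h x)

variable {ι κ ν : Type*} [Fintype κ]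

theorem norm_toEuclideanLin_eq_of_conjTranspose_mul_self_eq [Fintype ι] [DecidableEq ι] [Fintype ν]
    {M : Matrix κ ι 𝕜} {Q : Matrix ν ι 𝕜} (h : Mᴴ * M = Qᴴ * Q) (x : EuclideanSpace 𝕜 ι) :
    ‖M.toEuclideanLin x‖ = ‖Q.toEuclideanLin x‖ := by
  rw [norm_eq_sqrt_re_inner (𝕜 := 𝕜), norm_eq_sqrt_re_inner (𝕜 := 𝕜),
    ← inner_toEuclideanLin_conjTranspose_mul_self, h, inner_toEuclideanLin_conjTranspose_mul_self]

theorem exists_isometry_mul_eq [Finite ι] [DecidableEq κ] {M Q : Matrix κ ι 𝕜}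
    (h : Mᴴ * M = Qᴴ * Q) : ∃ U : Matrix κ κ 𝕜, Uᴴ * U = 1 ∧ U * Q = M := by
  classical
  cases nonempty_fintype ι
  obtain ⟨L, hL⟩ := exists_linearIsometry_range_apply_eq
    (norm_toEuclideanLin_eq_of_conjTranspose_mul_self_eq h)
  obtain ⟨U, hU⟩ := Matrix.toEuclideanLin.surjective L.extend.toLinearMap
  refine ⟨U, Matrix.toEuclideanLin.injective (LinearMap.ext fun x => ext_inner_left 𝕜 fun y => ?_),
    Matrix.toEuclideanLin.injective (LinearMap.ext fun x => ?_)⟩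
  · rw [inner_toEuclideanLin_conjTranspose_mul_self, hU, LinearIsometry.coe_toLinearMap,
      LinearIsometry.inner_map_map, Matrix.toLpLin_one, LinearMap.id_apply]
  · rw [Matrix.toLpLin_mul_same, hU, LinearMap.comp_apply, LinearIsometry.coe_toLinearMap, ← hL]
    exact L.extend_apply ⟨_, LinearMap.mem_range_self _ x⟩

theorem conjTranspose_mul_self_le_one [Fintype ι] [DecidableEq ι] {W : Matrix κ ι 𝕜}
    (hW : ∀ x, ‖W.toEuclideanLin x‖ ≤ ‖x‖) : Wᴴ * W ≤ 1 := by
  rw [Matrix.le_iff, ← Matrix.isPositive_toEuclideanLin_iff]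
  refine ⟨Matrix.isSymmetric_toEuclideanLin_iff.2
    (Matrix.isHermitian_one.sub (Matrix.isHermitian_conjTranspose_mul_self W)), fun x => ?_⟩
  rw [inner_re_symm, map_sub, LinearMap.sub_apply, inner_sub_right,
    inner_toEuclideanLin_conjTranspose_mul_self, Matrix.toLpLin_one, LinearMap.id_apply, map_sub,
    inner_self_eq_norm_sq, inner_self_eq_norm_sq, sub_nonneg]
  exact pow_le_pow_left₀ (norm_nonneg _) (hW x) 2

theorem exists_contraction_mul_eq [Finite ι] [Fintype ν] [DecidableEq ν]
    {M : Matrix κ ι 𝕜} {Q : Matrix ν ι 𝕜} (h : Mᴴ * M = Qᴴ * Q) :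
    ∃ W : Matrix κ ν 𝕜, Wᴴ * W ≤ 1 ∧ W * Q = M := by
  classical
  cases nonempty_fintype ι
  obtain ⟨L, hL⟩ := exists_linearIsometry_range_apply_eq
    (norm_toEuclideanLin_eq_of_conjTranspose_mul_self_eq h)
  let P := (LinearMap.range Q.toEuclideanLin).orthogonalProjectionOnto
  obtain ⟨W, hW⟩ := Matrix.toEuclideanLin.surjective (L.toLinearMap ∘ₗ P.toLinearMap)
  refine ⟨W, conjTranspose_mul_self_le_one fun x => ?_,
    Matrix.toEuclideanLin.injective (LinearMap.ext fun x => ?_)⟩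
  · rw [hW]
    exact (L.norm_map _).trans_le (Submodule.norm_orthogonalProjectionOnto_apply_le _ x)
  · rw [Matrix.toLpLin_mul_same, hW, ← hL]
    exact congrArg L (Submodule.orthogonalProjectionOnto_mem_subspace_eq_self
      ⟨_, LinearMap.mem_range_self _ x⟩)

end PolarDecomposition

section Uhlmann

open scoped Matrix

variable {ι κ : Type*} [Fintype ι] [Fintype κ]

/-- The matrix of coefficients of a vector of the composite space in the product basis. It turns
the inner product into the Hilbert–Schmidt one and purifications of `ρ` into solutions of
`A * Aᴴ = ρ`. -/
def coeffMatrix {ι κ : Type*} : EuclideanSpace ℂ (ι × κ) ≃ Matrix ι κ ℂ where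
  toFun ψ := Matrix.of fun i b => ψ (i, b)
  invFun A := WithLp.toLp 2 fun p => A p.1 p.2

theorem coeffMatrix_apply {ι κ : Type*} (ψ : EuclideanSpace ℂ (ι × κ)) (i : ι) (b : κ) :
    coeffMatrix ψ i b = ψ (i, b) := rfl

theorem isPurification_iff {ι : Type*} {ψ : EuclideanSpace ℂ (ι × κ)} {ρ : Matrix ι ι ℂ} :
    IsPurification ψ ρ ↔ coeffMatrix ψ * (coeffMatrix ψ)ᴴ = ρ := by
  rw [IsPurification]
  refine Eq.congr_left (Matrix.ext fun i j => ?_)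
  simp [partialTrace, ketBra, coeffMatrix_apply, Matrix.mul_apply]

theorem inner_eq_trace (ψ φ : EuclideanSpace ℂ (ι × κ)) :
    inner ℂ ψ φ = ((coeffMatrix ψ)ᴴ * coeffMatrix φ).trace := by
  simp only [PiLp.inner_apply, RCLike.inner_apply, Matrix.trace, Matrix.diag, Matrix.mul_apply,
    Matrix.conjTranspose_apply, coeffMatrix_apply, Fintype.sum_prod_type_right, starRingEnd_apply,
    mul_comm]

theorem IsPurification.norm_eq_one {ψ : EuclideanSpace ℂ (ι × κ)} {ρ : Matrix ι ι ℂ}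
    (h : IsPurification ψ ρ) (hρ : ρ.trace = 1) : ‖ψ‖ = 1 := by
  rw [norm_eq_sqrt_re_inner (𝕜 := ℂ), inner_eq_trace, Matrix.trace_mul_comm,
    isPurification_iff.1 h, hρ, RCLike.one_re, Real.sqrt_one]

theorem norm_trace_conjTranspose_mul_le (X Y : Matrix ι κ ℂ) :
    ‖(Xᴴ * Y).trace‖ ≤ √(Xᴴ * X).trace.re * √(Yᴴ * Y).trace.re := by
  have hnorm : ∀ Z : Matrix ι κ ℂ, √(Zᴴ * Z).trace.re = ‖coeffMatrix.symm Z‖ := fun Z => by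
    rw [norm_eq_sqrt_re_inner (𝕜 := ℂ), inner_eq_trace, Equiv.apply_symm_apply]
    rfl
  rw [hnorm, hnorm]
  simpa only [inner_eq_trace, Equiv.apply_symm_apply] using
    norm_inner_le_norm (𝕜 := ℂ) (coeffMatrix.symm X) (coeffMatrix.symm Y)

open scoped Classical in
theorem conjTranspose_sqrt (A : Matrix ι ι ℂ) : (CFC.sqrt A)ᴴ = CFC.sqrt A :=
  (Matrix.nonneg_iff_posSemidef.1 (CFC.sqrt_nonneg A)).isHermitian

open scoped Classical in
theorem conjTranspose_mul_sqrt_mul_self {ρ₀ ρ₁ : Matrix ι ι ℂ} {A : Matrix ι κ ℂ}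
    (hA : A * Aᴴ = ρ₀) : (Aᴴ * CFC.sqrt ρ₁)ᴴ * (Aᴴ * CFC.sqrt ρ₁)
      = (CFC.sqrt (CFC.sqrt ρ₁ * ρ₀ * CFC.sqrt ρ₁))ᴴ
        * CFC.sqrt (CFC.sqrt ρ₁ * ρ₀ * CFC.sqrt ρ₁) := by
  have hgram : (Aᴴ * CFC.sqrt ρ₁)ᴴ * (Aᴴ * CFC.sqrt ρ₁) = CFC.sqrt ρ₁ * ρ₀ * CFC.sqrt ρ₁ := by
    rw [Matrix.conjTranspose_mul, Matrix.conjTranspose_conjTranspose, conjTranspose_sqrt, ← hA]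
    simp only [Matrix.mul_assoc]
  have hnonneg : 0 ≤ CFC.sqrt ρ₁ * ρ₀ * CFC.sqrt ρ₁ :=
    hgram ▸ (Matrix.posSemidef_conjTranspose_mul_self _).nonneg
  rw [hgram, conjTranspose_sqrt (_ * _), CFC.sqrt_mul_sqrt_self _ hnonneg]

variable [DecidableEq ι]

theorem re_trace_conjTranspose_mul_self_le {W : Matrix κ ι ℂ} (hW : Wᴴ * W ≤ 1)
    {ν : Type*} [Fintype ν] (T : Matrix ι ν ℂ) :
    ((W * T)ᴴ * (W * T)).trace.re ≤ (Tᴴ * T).trace.re := by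
  have hnonneg := ((Matrix.le_iff.1 hW).conjTranspose_mul_mul_same T).trace_nonneg
  rw [Matrix.mul_sub, Matrix.sub_mul, Matrix.trace_sub, Matrix.mul_one, sub_nonneg] at hnonneg
  simpa only [Matrix.conjTranspose_mul, Matrix.mul_assoc] using (Complex.le_def.1 hnonneg).1

theorem norm_trace_mul_mul_conjTranspose_le {V W : Matrix κ ι ℂ} (hV : Vᴴ * V ≤ 1)
    (hW : Wᴴ * W ≤ 1) {Q : Matrix ι ι ℂ} (hQ : 0 ≤ Q) :
    ‖(V * Q * Wᴴ).trace‖ ≤ Q.trace.re := by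
  obtain ⟨T, rfl⟩ := CStarAlgebra.nonneg_iff_eq_star_mul_self.1 hQ
  rw [Matrix.star_eq_conjTranspose]
  have hHS : ∀ {B : Matrix κ ι ℂ}, Bᴴ * B ≤ 1 →
      ((B * Tᴴ)ᴴ * (B * Tᴴ)).trace.re ≤ (Tᴴ * T).trace.re := fun hB =>
    (re_trace_conjTranspose_mul_self_le hB Tᴴ).trans_eq (by
      rw [Matrix.conjTranspose_conjTranspose, Matrix.trace_mul_comm])
  calc ‖(V * (Tᴴ * T) * Wᴴ).trace‖ = ‖((W * Tᴴ)ᴴ * (V * Tᴴ)).trace‖ := by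
        rw [Matrix.trace_mul_comm _ (V * Tᴴ), Matrix.conjTranspose_mul,
          Matrix.conjTranspose_conjTranspose]
        simp only [Matrix.mul_assoc]
    _ ≤ √(Tᴴ * T).trace.re * √(Tᴴ * T).trace.re :=
        (norm_trace_conjTranspose_mul_le _ _).trans <|
          mul_le_mul (Real.sqrt_le_sqrt (hHS hW)) (Real.sqrt_le_sqrt (hHS hV))
            (Real.sqrt_nonneg _) (Real.sqrt_nonneg _)
    _ = (Tᴴ * T).trace.re := Real.mul_self_sqrt
        (Complex.le_def.1 (Matrix.posSemidef_conjTranspose_mul_self T).trace_nonneg).1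

theorem norm_inner_le_fidelity {ρ₀ ρ₁ : Matrix ι ι ℂ} {ψ₀ ψ₁ : EuclideanSpace ℂ (ι × κ)}
    (hψ₀ : IsPurification ψ₀ ρ₀) (hψ₁ : IsPurification ψ₁ ρ₁) :
    ‖inner ℂ ψ₀ ψ₁‖ ≤ fidelity ρ₀ ρ₁ := by
  rw [isPurification_iff] at hψ₀ hψ₁
  have hρ₁ : 0 ≤ ρ₁ := hψ₁ ▸ (Matrix.posSemidef_self_mul_conjTranspose _).nonneg
  obtain ⟨W, hW, hWmul⟩ := exists_contraction_mul_eq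
    (M := (coeffMatrix ψ₁)ᴴ) (Q := CFC.sqrt ρ₁) (by
      rw [Matrix.conjTranspose_conjTranspose, conjTranspose_sqrt, CFC.sqrt_mul_sqrt_self ρ₁, hψ₁])
  obtain ⟨V, hV, hVmul⟩ := exists_contraction_mul_eq
    (conjTranspose_mul_sqrt_mul_self (ρ₁ := ρ₁) hψ₀)
  have hcoeff : coeffMatrix ψ₁ = CFC.sqrt ρ₁ * Wᴴ := by
    rw [← Matrix.conjTranspose_conjTranspose (coeffMatrix ψ₁), ← hWmul, Matrix.conjTranspose_mul,
      conjTranspose_sqrt]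
  rw [inner_eq_trace, hcoeff, ← Matrix.mul_assoc, ← hVmul]
  exact norm_trace_mul_mul_conjTranspose_le hV hW (CFC.sqrt_nonneg _)

theorem exists_mul_conjTranspose_eq_one (h : Fintype.card ι ≤ Fintype.card κ) :
    ∃ J : Matrix ι κ ℂ, J * Jᴴ = 1 := by
  classical
  obtain ⟨f⟩ := Function.Embedding.nonempty_of_card_le h
  refine ⟨(1 : Matrix κ κ ℂ).submatrix f id, ?_⟩
  rw [Matrix.conjTranspose_submatrix, Matrix.conjTranspose_one,
    ← Matrix.submatrix_mul _ _ _ _ _ Function.bijective_id, Matrix.one_mul,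
    Matrix.submatrix_one _ f.injective]

theorem exists_isPurification_norm_inner_eq_fidelity {ρ₀ ρ₁ : Matrix ι ι ℂ} (h₀ : 0 ≤ ρ₀)
    (h₁ : 0 ≤ ρ₁) (hκ : Fintype.card ι ≤ Fintype.card κ) :
    ∃ ψ₀ ψ₁ : EuclideanSpace ℂ (ι × κ), IsPurification ψ₀ ρ₀ ∧ IsPurification ψ₁ ρ₁ ∧
      ‖inner ℂ ψ₀ ψ₁‖ = fidelity ρ₀ ρ₁ := by
  obtain ⟨J, hJ⟩ := exists_mul_conjTranspose_eq_one hκ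
  have hS₀ : CFC.sqrt ρ₀ * (CFC.sqrt ρ₀)ᴴ = ρ₀ := by
    rw [conjTranspose_sqrt, CFC.sqrt_mul_sqrt_self ρ₀]
  obtain ⟨U, hU, hUmul⟩ := exists_isometry_mul_eq (conjTranspose_mul_sqrt_mul_self (ρ₁ := ρ₁) hS₀)
  have hgram : ∀ B : Matrix ι ι ℂ, B * J * (B * J)ᴴ = B * Bᴴ := fun B => by
    rw [Matrix.conjTranspose_mul, Matrix.mul_assoc, ← Matrix.mul_assoc J, hJ, Matrix.one_mul]
  refine ⟨coeffMatrix.symm (CFC.sqrt ρ₀ * U * J), coeffMatrix.symm (CFC.sqrt ρ₁ * J), ?_, ?_, ?_⟩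
  · rw [isPurification_iff, Equiv.apply_symm_apply, hgram, Matrix.conjTranspose_mul,
      Matrix.mul_assoc, ← Matrix.mul_assoc U, mul_eq_one_comm.1 hU, Matrix.one_mul, hS₀]
  · rw [isPurification_iff, Equiv.apply_symm_apply, hgram, conjTranspose_sqrt,
      CFC.sqrt_mul_sqrt_self ρ₁]
  · rw [inner_eq_trace, Equiv.apply_symm_apply, Equiv.apply_symm_apply, Matrix.trace_mul_comm,
      Matrix.conjTranspose_mul, ← Matrix.mul_assoc, Matrix.mul_assoc _ J, hJ, Matrix.mul_one,
      Matrix.trace_mul_comm, Matrix.conjTranspose_mul, Matrix.mul_assoc, ← hUmul,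
      ← Matrix.mul_assoc, hU, Matrix.one_mul]
    exact congrArg Complex.re (Complex.norm_of_nonneg'
      (Matrix.nonneg_iff_posSemidef.1 (CFC.sqrt_nonneg _)).trace_nonneg)

end Uhlmann

section PartialTrace

open scoped Kronecker

variable {ι κ : Type*} [Fintype ι] [Fintype κ] [DecidableEq κ]

theorem trace_mul_kronecker_one (M : Matrix (ι × κ) (ι × κ) ℂ) (A : Matrix ι ι ℂ) :
    (M * (A ⊗ₖ (1 : Matrix κ κ ℂ))).trace = (partialTrace M * A).trace := by
  simp only [Matrix.trace, Matrix.diag, Matrix.mul_apply, partialTrace, Fintype.sum_prod_type,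
    Matrix.kroneckerMap_apply, Matrix.one_apply, mul_ite, mul_one, mul_zero, Finset.sum_ite_eq',
    Finset.mem_univ, if_true, Finset.sum_mul]
  exact Finset.sum_congr rfl fun i _ => Finset.sum_comm

theorem IsMeasurement.kronecker_one {ι κ : Type*} [Finite ι] [DecidableEq ι] [Finite κ]
    [DecidableEq κ] {m : ℕ} {E : Fin m → Matrix ι ι ℂ} (hE : IsMeasurement E) :
    IsMeasurement fun b => E b ⊗ₖ (1 : Matrix κ κ ℂ) := by
  cases nonempty_fintype ι
  cases nonempty_fintype κ
  refine ⟨fun b => (hE.posSemidef b).kronecker Matrix.PosSemidef.one, ?_⟩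
  rw [← Matrix.one_kronecker_one, ← hE.sum_eq_one]
  ext i j
  simp only [Matrix.sum_apply, Matrix.kroneckerMap_apply, Finset.sum_mul]

variable [DecidableEq ι]

theorem mutualInfoValues_partialTrace_subset (t : ℝ) (σ₀ σ₁ : Matrix (ι × κ) (ι × κ) ℂ) :
    mutualInfoValues t (partialTrace σ₀) (partialTrace σ₁) ⊆ mutualInfoValues t σ₀ σ₁ := by
  rintro x ⟨m, E, hE, rfl⟩
  have hprob : ∀ σ : Matrix (ι × κ) (ι × κ) ℂ, outcomeProb (partialTrace σ) E
      = outcomeProb σ fun b => E b ⊗ₖ (1 : Matrix κ κ ℂ) := fun σ =>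
    funext fun b => congrArg Complex.re (trace_mul_kronecker_one σ (E b)).symm
  refine ⟨m, _, hE.kronecker_one, ?_⟩
  simp only [mutualInfo, outcomeProb_averageState, hprob]

theorem IsPurification.mutualInfoValues_subset {ρ₀ ρ₁ : Matrix ι ι ℂ}
    {ψ₀ ψ₁ : EuclideanSpace ℂ (ι × κ)} (hψ₀ : IsPurification ψ₀ ρ₀) (hψ₁ : IsPurification ψ₁ ρ₁)
    (t : ℝ) : mutualInfoValues t ρ₀ ρ₁ ⊆ mutualInfoValues t (ketBra ψ₀) (ketBra ψ₁) :=
  hψ₀ ▸ hψ₁ ▸ mutualInfoValues_partialTrace_subset t _ _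

end PartialTrace

section PurificationBound

variable {ι κ : Type*} [Fintype ι] [DecidableEq ι] [Fintype κ] {ρ₀ ρ₁ : Matrix ι ι ℂ} {t : ℝ}

theorem IsPurification.accessibleInfo_ketBra [DecidableEq κ] {ψ₀ ψ₁ : EuclideanSpace ℂ (ι × κ)}
    (hψ₀ : IsPurification ψ₀ ρ₀) (hψ₁ : IsPurification ψ₁ ρ₁) (h₀ : ρ₀.trace = 1)
    (h₁ : ρ₁.trace = 1) (ht₀ : 0 ≤ t) (ht₁ : t ≤ 1) :
    accessibleInfo t (ketBra ψ₀) (ketBra ψ₁) = pureStateInfo t (‖inner ℂ ψ₀ ψ₁‖ ^ 2) :=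
  _root_.accessibleInfo_ketBra (hψ₀.norm_eq_one h₀) (hψ₁.norm_eq_one h₁) ht₀ ht₁

theorem IsPurification.pureStateInfo_mem_upperBounds {ψ₀ ψ₁ : EuclideanSpace ℂ (ι × κ)}
    (hψ₀ : IsPurification ψ₀ ρ₀) (hψ₁ : IsPurification ψ₁ ρ₁) (h₀ : ρ₀.trace = 1)
    (h₁ : ρ₁.trace = 1) (ht₀ : 0 ≤ t) (ht₁ : t ≤ 1) :
    pureStateInfo t (‖inner ℂ ψ₀ ψ₁‖ ^ 2) ∈ upperBounds (mutualInfoValues t ρ₀ ρ₁) := by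
  classical
  exact fun x hx => (isGreatest_mutualInfoValues_ketBra (hψ₀.norm_eq_one h₀)
    (hψ₁.norm_eq_one h₁) ht₀ ht₁).2 (hψ₀.mutualInfoValues_subset hψ₁ t hx)

theorem purificationBound_mem_upperBounds (h₀ : IsDensityOperator ρ₀) (h₁ : IsDensityOperator ρ₁)
    (ht₀ : 0 ≤ t) (ht₁ : t ≤ 1) :
    purificationBound t ρ₀ ρ₁ ∈ upperBounds (mutualInfoValues t ρ₀ ρ₁) := by
  obtain ⟨ψ₀, ψ₁, hψ₀, hψ₁, hF⟩ := exists_isPurification_norm_inner_eq_fidelity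
    h₀.posSemidef.nonneg h₁.posSemidef.nonneg (le_refl (Fintype.card ι))
  rw [purificationBound, ← hF]
  exact hψ₀.pureStateInfo_mem_upperBounds hψ₁ h₀.trace_eq_one h₁.trace_eq_one ht₀ ht₁

theorem isLeast_purificationBound (h₀ : IsDensityOperator ρ₀) (h₁ : IsDensityOperator ρ₁)
    (ht₀ : 0 ≤ t) (ht₁ : t ≤ 1) :
    IsLeast (purificationInfoValues t ρ₀ ρ₁) (purificationBound t ρ₀ ρ₁) := by
  obtain ⟨φ₀, φ₁, hφ₀, hφ₁, hF⟩ := exists_isPurification_norm_inner_eq_fidelity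
    h₀.posSemidef.nonneg h₁.posSemidef.nonneg (Fintype.card_fin (Fintype.card ι)).ge
  have hoverlap : ∀ (k : ℕ) (ψ₀ ψ₁ : EuclideanSpace ℂ (ι × Fin k)), IsPurification ψ₀ ρ₀ →
      IsPurification ψ₁ ρ₁ → ‖inner ℂ ψ₀ ψ₁‖ ^ 2 ∈ Set.Icc (0 : ℝ) 1 := fun k ψ₀ ψ₁ hψ₀ hψ₁ =>
    norm_inner_sq_mem_Icc (hψ₀.norm_eq_one h₀.trace_eq_one) (hψ₁.norm_eq_one h₁.trace_eq_one)
  rw [purificationBound, ← hF]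
  refine ⟨⟨_, φ₀, φ₁, hφ₀, hφ₁,
    (hφ₀.accessibleInfo_ketBra hφ₁ h₀.trace_eq_one h₁.trace_eq_one ht₀ ht₁).symm⟩, ?_⟩
  rintro x ⟨k, ψ₀, ψ₁, hψ₀, hψ₁, rfl⟩
  rw [hψ₀.accessibleInfo_ketBra hψ₁ h₀.trace_eq_one h₁.trace_eq_one ht₀ ht₁]
  refine antitoneOn_pureStateInfo ht₀ ht₁ (hoverlap k ψ₀ ψ₁ hψ₀ hψ₁) (hoverlap _ φ₀ φ₁ hφ₀ hφ₁) ?_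
  rw [hF]
  exact pow_le_pow_left₀ (norm_nonneg _) (norm_inner_le_fidelity hψ₀ hψ₁) 2

end PurificationBound

theorem mainTheorem11_general {ι : Type*} [Fintype ι] [DecidableEq ι] {ρ₀ ρ₁ : Matrix ι ι ℂ}
    (hρ₀ : IsDensityOperator ρ₀) (hρ₁ : IsDensityOperator ρ₁)
    {t : ℝ} (ht₀ : 0 ≤ t) (ht₁ : t ≤ 1) :
    (mutualInfoValues t ρ₀ ρ₁).Nonempty ∧ BddAbove (mutualInfoValues t ρ₀ ρ₁) ∧
    (∀ (κ : Type*) [Fintype κ] [DecidableEq κ] (ψ₀ ψ₁ : EuclideanSpace ℂ (ι × κ)),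
      IsPurification ψ₀ ρ₀ → IsPurification ψ₁ ρ₁ →
        accessibleInfo t ρ₀ ρ₁ ≤ accessibleInfo t (ketBra ψ₀) (ketBra ψ₁) ∧
        IsGreatest (mutualInfoValues t (ketBra ψ₀) (ketBra ψ₁))
          (accessibleInfo t (ketBra ψ₀) (ketBra ψ₁)) ∧
        accessibleInfo t (ketBra ψ₀) (ketBra ψ₁) =
          pureStateInfo t (‖inner ℂ ψ₀ ψ₁‖ ^ 2) ∧
        ‖inner ℂ ψ₀ ψ₁‖ ^ 2 ≤ fidelity ρ₀ ρ₁ ^ 2) ∧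
    (∀ (κ : Type*) [Fintype κ], Fintype.card ι ≤ Fintype.card κ →
      ∃ ψ₀ ψ₁ : EuclideanSpace ℂ (ι × κ), IsPurification ψ₀ ρ₀ ∧ IsPurification ψ₁ ρ₁ ∧
        ‖inner ℂ ψ₀ ψ₁‖ ^ 2 = fidelity ρ₀ ρ₁ ^ 2) ∧
    AntitoneOn (fun q => pureStateInfo t q) (Set.Icc 0 1) ∧
    accessibleInfo t ρ₀ ρ₁ ≤ purificationBound t ρ₀ ρ₁ ∧
    IsLeast (purificationInfoValues t ρ₀ ρ₁) (purificationBound t ρ₀ ρ₁) := by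
  have hne := mutualInfoValues_nonempty t ρ₀ ρ₁
  have hbound := purificationBound_mem_upperBounds hρ₀ hρ₁ ht₀ ht₁
  refine ⟨hne, ⟨_, hbound⟩, ?purifications, ?attained, antitoneOn_pureStateInfo ht₀ ht₁,
    csSup_le hne hbound, isLeast_purificationBound hρ₀ hρ₁ ht₀ ht₁⟩
  case purifications =>
    intro κ _ _ ψ₀ ψ₁ hψ₀ hψ₁
    have hmax := isGreatest_mutualInfoValues_ketBra (hψ₀.norm_eq_one hρ₀.trace_eq_one)
      (hψ₁.norm_eq_one hρ₁.trace_eq_one) ht₀ ht₁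
    rw [hψ₀.accessibleInfo_ketBra hψ₁ hρ₀.trace_eq_one hρ₁.trace_eq_one ht₀ ht₁]
    exact ⟨csSup_le hne (hψ₀.pureStateInfo_mem_upperBounds hψ₁ hρ₀.trace_eq_one hρ₁.trace_eq_one
      ht₀ ht₁), hmax, rfl, pow_le_pow_left₀ (norm_nonneg _) (norm_inner_le_fidelity hψ₀ hψ₁) 2⟩
  case attained =>
    intro κ _ hκ
    obtain ⟨ψ₀, ψ₁, hψ₀, hψ₁, hF⟩ := exists_isPurification_norm_inner_eq_fidelity
      hρ₀.posSemidef.nonneg hρ₁.posSemidef.nonneg hκ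
    exact ⟨ψ₀, ψ₁, hψ₀, hψ₁, congrArg (· ^ 2) hF⟩

theorem mainTheorem11 (D : ℕ) (ρ₀ ρ₁ : Matrix (Fin D) (Fin D) ℂ)
    (hρ₀ : IsDensityOperator ρ₀) (hρ₁ : IsDensityOperator ρ₁)
    (t : ℝ) (ht₀ : 0 ≤ t) (ht₁ : t ≤ 1) :
    -- the supremum defining the accessible information is over a bounded nonempty set
    (mutualInfoValues t ρ₀ ρ₁).Nonempty ∧ BddAbove (mutualInfoValues t ρ₀ ρ₁) ∧
    -- every pair of purifications gives an upper bound, explicitly computed from its overlap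
    (∀ (k : ℕ) (ψ₀ ψ₁ : EuclideanSpace ℂ (Fin D × Fin k)),
      IsPurification ψ₀ ρ₀ → IsPurification ψ₁ ρ₁ →
        accessibleInfo t ρ₀ ρ₁ ≤ accessibleInfo t (ketBra ψ₀) (ketBra ψ₁) ∧
        IsGreatest (mutualInfoValues t (ketBra ψ₀) (ketBra ψ₁))
          (accessibleInfo t (ketBra ψ₀) (ketBra ψ₁)) ∧
        accessibleInfo t (ketBra ψ₀) (ketBra ψ₁) =
          pureStateInfo t (‖inner ℂ ψ₀ ψ₁‖ ^ 2) ∧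
        ‖inner ℂ ψ₀ ψ₁‖ ^ 2 ≤ fidelity ρ₀ ρ₁ ^ 2) ∧
    -- the largest overlap is attained, already with an auxiliary system of dimension `D`
    (∃ ψ₀ ψ₁ : EuclideanSpace ℂ (Fin D × Fin D),
      IsPurification ψ₀ ρ₀ ∧ IsPurification ψ₁ ρ₁ ∧
        ‖inner ℂ ψ₀ ψ₁‖ ^ 2 = fidelity ρ₀ ρ₁ ^ 2) ∧
    -- a larger overlap gives a tighter bound
    AntitoneOn (fun q => pureStateInfo t q) (Set.Icc 0 1) ∧
    -- the bound `P(t)`, the best one obtained from purifications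
    accessibleInfo t ρ₀ ρ₁ ≤ purificationBound t ρ₀ ρ₁ ∧
    IsLeast (purificationInfoValues t ρ₀ ρ₁) (purificationBound t ρ₀ ρ₁) := by
  obtain ⟨hne, hbdd, hpure, hattained, hrest⟩ := mainTheorem11_general hρ₀ hρ₁ ht₀ ht₁
  exact ⟨hne, hbdd, fun k => hpure (Fin k), hattained (Fin D) le_rfl, hrest⟩
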